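/- Let $\mathcal H$ be a real or complex Hilbert space. A linear operator $T$ in $\mathcal H$ with domain $\operatorname{dom}T$ is called positive symmetric if $\langle Tf,g\rangle=\langle f,Tg\rangle$ and $\langle Tf,f\rangle\ge 0$ for all $f,g\in\operatorname{dom}T$; a positive symmetric operator $S$ is called positive self-adjoint if it is densely defined and $S^*=S$. For positive self-adjoint $S_1,S_2$ write $S_1\preceq S_2$ if $(I+S_2)^{-1}\le (I+S_1)^{-1}$. Let $T$ be a densely defined positive symmetric operator in $\mathcal H$. Let $\mathcal E_T$ be the Hilbert space completion of $\operatorname{ran}T$ with respect to the (well-defined) inner product $\langle Tf,Th\rangle_T:=\langle Tf,h\rangle$, $f,h\in\operatorname{dom}T$. Let $J_T:\mathcal E_T\to\mathcal H$ be the operator with domain $\operatorname{ran}T\subseteq\mathcal E_T$ given by $J_T(Th):=Th$, and let $Q_T:\mathcal H\to\mathcal E_T$ be the restriction of $J_T^*$ to $\operatorname{dom}T$. Put $$T_N:=J_T^{**}J_T^{*}\quad\text{(the Krein--von Neumann extension)},\qquad T_F:=Q_T^{*}Q_T^{**}\quad\text{(the Friedrichs extension)},$$ products being taken on their natural domains.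 Then $T_N$ and $T_F$ are positive self-adjoint extensions of $T$, and the positive self-adjoint extensions of $T$ form the operator interval $[T_N,T_F]$: $$\{S : S \text{ is a positive self-adjoint extension of } T\}=\{S : S \text{ is positive self-adjoint and } T_N\preceq S\preceq T_F\}.$$ -/

import Mathlib

/-! # Positive symmetric operators, energy space, Krein-von Neumann and Friedrichs extensions

Operators in a real or complex Hilbert space are Mathlib's partially defined linear maps
`E →ₗ.[𝕜] F`; `T ≤ S` means that `S` extends `T`, and `T.adjoint` is the adjoint. Mathlib's inner
product is linear in the second variable. -/

noncomputable section

namespace LinearPMap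

variable {𝕜 E F G H : Type*} [RCLike 𝕜]
  [NormedAddCommGroup E] [InnerProductSpace 𝕜 E]
  [NormedAddCommGroup F] [InnerProductSpace 𝕜 F]
  [NormedAddCommGroup G] [InnerProductSpace 𝕜 G]
  [NormedAddCommGroup H] [InnerProductSpace 𝕜 H]

/-- `T` is positive symmetric: `⟪T f, g⟫ = ⟪f, T g⟫` and `⟪T f, f⟫ ≥ 0` on its domain (which need
not be dense). By symmetry `⟪T f, f⟫` is automatically real. -/
def IsPositiveSymmetric (T : H →ₗ.[𝕜] H) : Prop :=
  (∀ f g : T.domain, inner 𝕜 (T f) (g : H) = inner 𝕜 (f : H) (T g)) ∧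
    ∀ f : T.domain, 0 ≤ RCLike.re (inner 𝕜 (T f) (f : H))

/-- `S` is a positive self-adjoint operator: densely defined, `S* = S`, and positive symmetric. -/
def IsPositiveSelfAdjoint [CompleteSpace H] (S : H →ₗ.[𝕜] H) : Prop :=
  Dense (S.domain : Set H) ∧ S.adjoint = S ∧ S.IsPositiveSymmetric

/-- The product `B A` of two partially defined operators on its natural domain
`{x ∈ dom A | A x ∈ dom B}`. -/
def product (B : F →ₗ.[𝕜] G) (A : E →ₗ.[𝕜] F) : E →ₗ.[𝕜] G where
  domain := (B.domain.comap A.toFun).map A.domain.subtype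
  toFun :=
    { toFun := fun x => B ⟨A ⟨x, by
          obtain ⟨y, -, hy⟩ := x.2
          exact hy ▸ y.2⟩, by
          obtain ⟨x, y, hy, rfl⟩ := x
          exact hy⟩
      map_add' := fun x y => by
        rw [← LinearPMap.map_add]
        congr 1
        ext
        simp only [Submodule.coe_add]
        rw [← LinearPMap.map_add]
        rfl
      map_smul' := fun c x => by
        rw [RingHom.id_apply, ← LinearPMap.map_smul]
        congr 1
        ext
        simp only [Submodule.coe_smul]
        rw [← LinearPMap.map_smul]
        rfl }

theorem mem_product_graph_iff (B : F →ₗ.[𝕜] G) (A : E →ₗ.[𝕜] F) (x : E) (z : G) :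
    (x, z) ∈ (product B A).graph ↔ ∃ y, (x, y) ∈ A.graph ∧ (y, z) ∈ B.graph := by
  simp only [mem_graph_iff]
  constructor
  · rintro ⟨⟨_, y, hy, rfl⟩, rfl, rfl⟩
    exact ⟨A y, ⟨y, rfl, rfl⟩, ⟨A y, hy⟩, rfl, rfl⟩
  · rintro ⟨_, ⟨x, rfl, rfl⟩, ⟨y, hy⟩, h, rfl⟩
    obtain rfl : y = A x := h
    exact ⟨⟨x, x, hy, rfl⟩, rfl, rfl⟩

/-! ### The form order -/

/-- The operator `(I + S)⁻¹`. -/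
def oneAddInverse (S : H →ₗ.[𝕜] H) : H →ₗ.[𝕜] H :=
  (LinearMap.toPMap (LinearMap.id : H →ₗ[𝕜] H) ⊤ + S).inverse

/-- `A ≤ B` for everywhere defined operators in the usual (quadratic form) sense: `B - A` is
positive symmetric. -/
def OperatorLE (A B : H →ₗ.[𝕜] H) : Prop :=
  A.domain = ⊤ ∧ B.domain = ⊤ ∧ (B - A).IsPositiveSymmetric

/-- The form order `S₁ ⪯ S₂` of positive self-adjoint operators: `(I + S₂)⁻¹ ≤ (I + S₁)⁻¹`. -/
def FormLE (S₁ S₂ : H →ₗ.[𝕜] H) : Prop :=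
  OperatorLE S₂.oneAddInverse S₁.oneAddInverse

/-! ### The energy space -/

/-- The range of a positive symmetric `T` as a bare vector space, to be equipped with the energy
inner product instead of the one inherited from `H`. -/
def EnergyRange (T : H →ₗ.[𝕜] H) (_hT : T.IsPositiveSymmetric) : Type _ :=
  LinearMap.range T.toFun

instance instAddCommGroupEnergyRange (T : H →ₗ.[𝕜] H) (hT : T.IsPositiveSymmetric) :
    AddCommGroup (EnergyRange T hT) :=
  inferInstanceAs (AddCommGroup (LinearMap.range T.toFun))

instance instModuleEnergyRange (T : H →ₗ.[𝕜] H) (hT : T.IsPositiveSymmetric) :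
    Module 𝕜 (EnergyRange T hT) :=
  inferInstanceAs (Module 𝕜 (LinearMap.range T.toFun))

namespace EnergyRange

variable (T : H →ₗ.[𝕜] H) (hT : T.IsPositiveSymmetric)

/-- The inclusion of `ran T` into `H`. -/
def incl : EnergyRange T hT →ₗ[𝕜] H := (LinearMap.range T.toFun).subtype

/-- The vector `T h` of `ran T`. -/
def of (h : T.domain) : EnergyRange T hT := ⟨T h, h, rfl⟩

/-- The inner product `⟪T f, T h⟫_T = ⟪T f, h⟫` on `ran T`. It does not depend on the chosen `h`,
see `innerAux_of_of`. -/
def innerAux (x y : EnergyRange T hT) : 𝕜 :=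
  inner 𝕜 (incl T hT x) ((Classical.choose y.2 : T.domain) : H)

theorem innerAux_of_of (f h : T.domain) :
    innerAux T hT (of T hT f) (of T hT h) = inner 𝕜 (T f) (h : H) := by
  have hs : T (Classical.choose (of T hT h).2) = T h := Classical.choose_spec (of T hT h).2
  change inner 𝕜 (T f) ((Classical.choose (of T hT h).2 : T.domain) : H) = _
  rw [hT.1, hs, hT.1]

theorem exists_of (x : EnergyRange T hT) : ∃ f, of T hT f = x := by
  obtain ⟨_, f, rfl⟩ := x
  exact ⟨f, rfl⟩

theorem of_add (f g : T.domain) : of T hT f + of T hT g = of T hT (f + g) :=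
  Subtype.ext (T.map_add f g).symm

theorem smul_of (c : 𝕜) (f : T.domain) : c • of T hT f = of T hT (c • f) :=
  Subtype.ext (T.map_smul c f).symm

/-- The energy inner product on `ran T`. -/
abbrev core : PreInnerProductSpace.Core 𝕜 (EnergyRange T hT) where
  inner := innerAux T hT
  conj_inner_symm x y := by
    obtain ⟨f, rfl⟩ := exists_of T hT x
    obtain ⟨g, rfl⟩ := exists_of T hT y
    rw [innerAux_of_of, innerAux_of_of, hT.1 f g, inner_conj_symm]
  re_inner_nonneg x := by
    obtain ⟨f, rfl⟩ := exists_of T hT x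
    rw [innerAux_of_of]
    exact hT.2 f
  add_left x y z := by
    exact inner_add_left (𝕜 := 𝕜) (incl T hT x) (incl T hT y) _
  smul_left x y r := by
    exact inner_smul_left (𝕜 := 𝕜) (incl T hT x) _ r

end EnergyRange

instance instSeminormedEnergyRange (T : H →ₗ.[𝕜] H) (hT : T.IsPositiveSymmetric) :
    SeminormedAddCommGroup (EnergyRange T hT) :=
  @InnerProductSpace.Core.toSeminormedAddCommGroup 𝕜 (EnergyRange T hT) _ _ _
    (EnergyRange.core T hT)

instance instInnerProductSpaceEnergyRange (T : H →ₗ.[𝕜] H) (hT : T.IsPositiveSymmetric) :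
    InnerProductSpace 𝕜 (EnergyRange T hT) :=
  InnerProductSpace.ofCore (EnergyRange.core T hT)

theorem EnergyRange.inner_of_of (T : H →ₗ.[𝕜] H) (hT : T.IsPositiveSymmetric) (f h : T.domain) :
    inner 𝕜 (EnergyRange.of T hT f) (EnergyRange.of T hT h) = inner 𝕜 (T f) (h : H) :=
  EnergyRange.innerAux_of_of T hT f h

/-- The energy space of `T`: the Hilbert space completion of `ran T` for the energy inner
product. -/
abbrev EnergySpace (T : H →ₗ.[𝕜] H) (hT : T.IsPositiveSymmetric) : Type _ :=
  UniformSpace.Completion (EnergyRange T hT)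

/-- The linear subspace `{(T h, T h) | h ∈ dom T}` of `EnergySpace × H`. -/
def energyGraph (T : H →ₗ.[𝕜] H) (hT : T.IsPositiveSymmetric) :
    Submodule 𝕜 (EnergySpace T hT × H) :=
  LinearMap.range
    ((UniformSpace.Completion.toComplₗᵢ (𝕜 := 𝕜) (E := EnergyRange T hT)).toLinearMap.prod
      (EnergyRange.incl T hT))

/-- The natural embedding `J_T` of `ran T`, as a subspace of the energy space, into `H`: the
operator whose graph is `{(T h, T h) | h ∈ dom T}`. -/
def energyEmbedding (T : H →ₗ.[𝕜] H) (hT : T.IsPositiveSymmetric) : EnergySpace T hT →ₗ.[𝕜] H :=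
  (energyGraph T hT).toLinearPMap

/-- For densely defined `T` the subspace used above is indeed the graph of an operator. -/
theorem energyEmbedding_graph (T : H →ₗ.[𝕜] H) (hT : T.IsPositiveSymmetric)
    (hd : Dense (T.domain : Set H)) : (energyEmbedding T hT).graph = energyGraph T hT := by
  apply Submodule.toLinearPMap_graph_eq
  rintro _ ⟨x, rfl⟩ hx
  obtain ⟨f, rfl⟩ := EnergyRange.exists_of T hT x
  have h0 : ‖EnergyRange.of T hT f‖ = 0 := by
    rw [← UniformSpace.Completion.norm_coe]
    exact norm_eq_zero.mpr hx
  refine hd.eq_zero_of_inner_left 𝕜 (x := T f) fun k hk => ?_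
  have h1 := norm_inner_le_norm (𝕜 := 𝕜) (EnergyRange.of T hT f) (EnergyRange.of T hT ⟨k, hk⟩)
  rw [h0, zero_mul, EnergyRange.inner_of_of] at h1
  exact norm_le_zero_iff.mp h1

/-! ### The two extremal extensions -/

/-- The Krein-von Neumann extension `T_N = J_T** J_T*`. -/
def kreinVonNeumannExtension [CompleteSpace H] (T : H →ₗ.[𝕜] H) (hT : T.IsPositiveSymmetric) :
    H →ₗ.[𝕜] H :=
  product (energyEmbedding T hT).adjoint.adjoint (energyEmbedding T hT).adjoint

/-- The restriction `Q_T` of `J_T*` to `dom T`. -/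
def energyRestriction [CompleteSpace H] (T : H →ₗ.[𝕜] H) (hT : T.IsPositiveSymmetric) :
    H →ₗ.[𝕜] EnergySpace T hT :=
  (energyEmbedding T hT).adjoint.domRestrict T.domain

/-- The Friedrichs extension `T_F = Q_T* Q_T**`. -/
def friedrichsExtension [CompleteSpace H] (T : H →ₗ.[𝕜] H) (hT : T.IsPositiveSymmetric) :
    H →ₗ.[𝕜] H :=
  product (energyRestriction T hT).adjoint (energyRestriction T hT).adjoint.adjoint

end LinearPMap

end

noncomputable section

namespace LinearPMap

/-! ### Graphs of adjoints. -/

section Graph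

variable {𝕜 E F : Type*} [RCLike 𝕜]
  [NormedAddCommGroup E] [InnerProductSpace 𝕜 E]
  [NormedAddCommGroup F] [InnerProductSpace 𝕜 F]

/-! Write `J`, `Q` for `energyEmbedding`, `energyRestriction`. Both extensions are of the form `A*
A` with `A` closed, so projecting `(h, 0)` onto the graph of `A` solves `x + A* A x = h`; a positive
symmetric operator with `1 + P` onto is self-adjoint.

For an extension `S`, the two inequalities compare forms through the variational fact that `⟪(1 +
S)⁻¹ k, k⟫` is the supremum of `2 re ⟪p, k⟫ - ‖p‖² - s[p]`, with `s` the form of `S`. Cauchy-Schwarz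
for `s` gives `‖J* x‖² ≤ ⟪x, S x⟫`, so the form of `T_N` is the smaller one. The form of `T_F` is
the closure of that of `T`, on whose domain `s` agrees with it, so its supremum runs over fewer
vectors.

Conversely, all resolvents of extensions send `f + T f` to `f`. If `S` lies between `T_N` and `T_F`,
then `(1 + S)⁻¹ - (1 + T_F)⁻¹` is nonnegative with vanishing form at `f + T f`, hence kills it, and
`S f = T f`. -/

theorem mem_adjoint_graph_iff [CompleteSpace E] {A : E →ₗ.[𝕜] F} (hA : Dense (A.domain : Set E))
    {x : F} {y : E} :
    (x, y) ∈ A.adjoint.graph ↔ ∀ u v, (u, v) ∈ A.graph → inner 𝕜 v x = inner 𝕜 u y := by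
  rw [adjoint_graph_eq_graph_adjoint hA, Submodule.mem_adjoint_iff]
  simp only [sub_eq_zero]

theorem inner_eq_of_mem_adjoint_graph [CompleteSpace E] {A : E →ₗ.[𝕜] F}
    (hA : Dense (A.domain : Set E)) {x v : F} {y u : E} (hxy : (x, y) ∈ A.adjoint.graph)
    (huv : (u, v) ∈ A.graph) : inner 𝕜 y u = inner 𝕜 x v := by
  rw [← inner_conj_symm y, ← inner_conj_symm x, (mem_adjoint_graph_iff hA).1 hxy u v huv]

theorem le_adjoint_adjoint [CompleteSpace E] [CompleteSpace F] {A : E →ₗ.[𝕜] F}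
    (hA : Dense (A.domain : Set E)) (hA' : Dense (A.adjoint.domain : Set F)) :
    A ≤ A.adjoint.adjoint :=
  (adjoint_isFormalAdjoint hA).le_adjoint hA'

/-- Orthogonal decomposition of `(h, 0)` along the closure of the graph of `A`. -/
theorem exists_mem_closure_graph_of_dense [CompleteSpace E] [CompleteSpace F] {A : E →ₗ.[𝕜] F}
    (hA : Dense (A.domain : Set E)) (h : E) :
    ∃ x y, (x, y) ∈ A.graph.topologicalClosure ∧ (y, h - x) ∈ A.adjoint.graph := by
  -- The product `E × F` carries the sup norm; orthogonal projection needs its `L²` version.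
  let e := WithLp.prodContinuousLinearEquiv 2 𝕜 E F
  let M : Submodule 𝕜 (WithLp 2 (E × F)) :=
    A.graph.topologicalClosure.comap (e : WithLp 2 (E × F) →ₗ[𝕜] E × F)
  have hM : _root_.IsClosed (M : Set (WithLp 2 (E × F))) :=
    A.graph.isClosed_topologicalClosure.preimage e.continuous
  have : CompleteSpace M := hM.completeSpace_coe
  obtain ⟨m, hm, n, hn, hmn⟩ := M.exists_add_mem_mem_orthogonal (WithLp.toLp 2 (h, (0 : F)))
  refine ⟨m.fst, m.snd, hm, (mem_adjoint_graph_iff hA).2 fun u v huv => ?_⟩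
  have h1 : h = m.fst + n.fst := congrArg (fun w => WithLp.fst w) hmn
  have h2 : 0 = m.snd + n.snd := congrArg (fun w => WithLp.snd w) hmn
  have h3 : inner 𝕜 (WithLp.toLp 2 (u, v)) n = 0 :=
    hn _ (A.graph.le_topologicalClosure huv)
  have h4 : inner 𝕜 u n.fst + inner 𝕜 v n.snd = 0 := h3
  rw [h1, add_sub_cancel_left, eq_neg_of_add_eq_zero_left h2.symm, inner_neg_right]
  exact (eq_neg_of_add_eq_zero_left h4).symm

theorem mem_oneAdd_graph_iff {S : E →ₗ.[𝕜] E} {x h : E} :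
    (x, h) ∈ (LinearMap.toPMap (LinearMap.id : E →ₗ[𝕜] E) ⊤ + S).graph ↔
      (x, h - x) ∈ S.graph := by
  simp only [mem_graph_iff]
  constructor
  · rintro ⟨⟨x, hx⟩, rfl, rfl⟩
    refine ⟨⟨x, hx.2⟩, rfl, ?_⟩
    simp [add_apply]
  · rintro ⟨⟨x, hx⟩, rfl, h1⟩
    refine ⟨⟨x, trivial, hx⟩, rfl, ?_⟩
    simp only [add_apply]
    change x + S ⟨x, hx⟩ = h
    rw [h1]
    simp

end Graph

variable {𝕜 E H : Type*} [RCLike 𝕜] [NormedAddCommGroup H] [InnerProductSpace 𝕜 H]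
  [NormedAddCommGroup E] [InnerProductSpace 𝕜 E]

/-! ### Positive symmetric operators and a range criterion for self-adjointness. -/

section Positive

theorem IsPositiveSymmetric.inner_eq {P : H →ₗ.[𝕜] H} (hP : P.IsPositiveSymmetric) {x y u v : H}
    (hxy : (x, y) ∈ P.graph) (huv : (u, v) ∈ P.graph) : inner 𝕜 y u = inner 𝕜 x v := by
  obtain ⟨x, rfl, rfl⟩ := (mem_graph_iff P).1 hxy
  obtain ⟨u, rfl, rfl⟩ := (mem_graph_iff P).1 huv
  exact hP.1 x u

theorem IsPositiveSymmetric.re_inner_nonneg {P : H →ₗ.[𝕜] H} (hP : P.IsPositiveSymmetric)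
    {x y : H} (hxy : (x, y) ∈ P.graph) : 0 ≤ RCLike.re (inner 𝕜 x y) := by
  obtain ⟨x, rfl, rfl⟩ := (mem_graph_iff P).1 hxy
  rw [← inner_conj_symm, RCLike.conj_re]
  exact hP.2 x

theorem IsPositiveSymmetric.eq_zero_of_neg_mem_graph {P : H →ₗ.[𝕜] H}
    (hP : P.IsPositiveSymmetric) {x : H} (hx : (x, -x) ∈ P.graph) : x = 0 := by
  have h := hP.re_inner_nonneg hx
  rw [inner_neg_right, _root_.map_neg, inner_self_eq_norm_sq] at h
  exact norm_eq_zero.1 (by nlinarith [norm_nonneg x])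

theorem IsPositiveSymmetric.eq_of_mem_graph {P : H →ₗ.[𝕜] H} (hP : P.IsPositiveSymmetric)
    {h x x' : H} (hx : (x, h - x) ∈ P.graph) (hx' : (x', h - x') ∈ P.graph) : x = x' := by
  refine sub_eq_zero.1 (hP.eq_zero_of_neg_mem_graph ?_)
  have := P.graph.sub_mem hx hx'
  rwa [Prod.mk_sub_mk, sub_sub_sub_cancel_left, ← neg_sub x x'] at this

/-- Cauchy-Schwarz inequality for the form of a positive symmetric operator. -/
theorem IsPositiveSymmetric.norm_inner_sq_le {P : H →ₗ.[𝕜] H} (hP : P.IsPositiveSymmetric)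
    {x y u v : H} (hxy : (x, y) ∈ P.graph) (huv : (u, v) ∈ P.graph) :
    ‖inner 𝕜 y u‖ ^ 2 ≤ RCLike.re (inner 𝕜 x y) * RCLike.re (inner 𝕜 u v) := by
  obtain ⟨x, rfl, rfl⟩ := (mem_graph_iff P).1 hxy
  obtain ⟨u, rfl, rfl⟩ := (mem_graph_iff P).1 huv
  -- The form of `P` is the energy inner product of `P` itself.
  have h := inner_mul_inner_self_le (𝕜 := 𝕜) (EnergyRange.of P hP x) (EnergyRange.of P hP u)
  simp only [EnergyRange.inner_of_of] at h
  rwa [norm_inner_symm ((P u : H)), ← hP.1, ← sq, hP.1 x x, hP.1 u u] at h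

/-- A positive symmetric operator `P` such that `1 + P` is surjective is self-adjoint. -/
theorem IsPositiveSymmetric.isPositiveSelfAdjoint [CompleteSpace H] {P : H →ₗ.[𝕜] H}
    (hP : P.IsPositiveSymmetric) (hs : ∀ h, ∃ x, (x, h - x) ∈ P.graph) :
    P.IsPositiveSelfAdjoint := by
  have hd : Dense (P.domain : Set H) := by
    rw [Submodule.dense_iff_topologicalClosure_eq_top,
      Submodule.topologicalClosure_eq_top_iff, Submodule.eq_bot_iff]
    intro y hy
    obtain ⟨x, hx⟩ := hs y
    have h1 : inner 𝕜 x y = 0 := hy x (mem_domain_of_mem_graph hx)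
    have h2 := hP.re_inner_nonneg hx
    rw [inner_sub_right, h1, zero_sub, _root_.map_neg, inner_self_eq_norm_sq] at h2
    have h3 : x = 0 := norm_eq_zero.1 (by nlinarith [norm_nonneg x])
    have := P.graph_fst_eq_zero_snd hx h3
    rwa [h3, sub_zero] at this
  refine ⟨hd, le_antisymm ?_ ?_, hP⟩
  · refine le_of_le_graph ?_
    rintro ⟨u, w⟩ huw
    -- Here `u - x` is annihilated by `1 + P*`, hence orthogonal to the range of `1 + P`; `z`
    -- exhibits `u - x` in that range.
    obtain ⟨x, hx⟩ := hs (w + u)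
    obtain ⟨z, hz⟩ := hs (u - x)
    have h1 := (mem_adjoint_graph_iff hd).1 huw _ _ hz
    have h2 := hP.inner_eq hz hx
    have h3 : u - x = 0 := by
      rw [← inner_self_eq_zero (𝕜 := 𝕜)]
      simp only [inner_sub_left, inner_sub_right, inner_add_right] at h1 h2 ⊢
      linear_combination h1 - h2
    obtain rfl : u = x := sub_eq_zero.1 h3
    simpa using hx
  · exact IsFormalAdjoint.le_adjoint hd hP.1

/-- The form of `B A` is `⟪A f, A g⟫`. -/
theorem isPositiveSymmetric_product {A : H →ₗ.[𝕜] E} {B : E →ₗ.[𝕜] H}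
    (h : B.IsFormalAdjoint A) : (product B A).IsPositiveSymmetric := by
  have key : ∀ f : (product B A).domain, ∃ (x : A.domain) (y : B.domain),
      (x : H) = f ∧ A x = (y : E) ∧ B y = product B A f := by
    intro f
    obtain ⟨y, hfy, hy⟩ := (mem_product_graph_iff B A _ _).1 ((product B A).mem_graph f)
    obtain ⟨x, hx, hxy⟩ := (mem_graph_iff A).1 hfy
    obtain ⟨y', hy', hyz⟩ := (mem_graph_iff B).1 hy
    exact ⟨x, y', hx, hxy.trans hy'.symm, hyz⟩
  have key2 : ∀ f g : (product B A).domain, ∃ x y : A.domain, (x : H) = f ∧ (y : H) = g ∧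
      inner 𝕜 (product B A f) (g : H) = inner 𝕜 (A x) (A y) := by
    intro f g
    obtain ⟨x, y, hx, hxy, hy⟩ := key f
    obtain ⟨x', _, hx', -, -⟩ := key g
    exact ⟨x, x', hx, hx', by rw [← hy, ← hx', h, hxy]⟩
  refine ⟨fun f g => ?_, fun f => ?_⟩
  · obtain ⟨x, y, hx, hy, h1⟩ := key2 f g
    obtain ⟨y', x', hy', hx', h2⟩ := key2 g f
    obtain rfl : x = x' := Subtype.ext (hx.trans hx'.symm)
    obtain rfl : y = y' := Subtype.ext (hy.trans hy'.symm)
    rw [h1, ← inner_conj_symm (f : H), h2, inner_conj_symm]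
  · obtain ⟨x, y, hx, hy, h1⟩ := key2 f f
    obtain rfl : x = y := Subtype.ext (hx.trans hy.symm)
    rw [h1]
    exact inner_self_nonneg

end Positive

/-! ### The energy space and the two extremal extensions. -/

section Energy

variable (T : H →ₗ.[𝕜] H) (hT : T.IsPositiveSymmetric)

/-- The vector `T f` of the energy space. -/
def energyOf (f : T.domain) : EnergySpace T hT :=
  ((EnergyRange.of T hT f : EnergyRange T hT) : EnergySpace T hT)

theorem inner_energyOf (f g : T.domain) :
    inner 𝕜 (energyOf T hT f) (energyOf T hT g) = inner 𝕜 (T f) (g : H) :=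
  (UniformSpace.Completion.inner_coe _ _).trans (EnergyRange.inner_of_of T hT f g)

theorem denseRange_energyOf : DenseRange (energyOf T hT) :=
  UniformSpace.Completion.denseRange_coe.comp
    (Function.Surjective.denseRange (EnergyRange.exists_of T hT))
    (UniformSpace.Completion.continuous_coe _)

variable {T} (hd : Dense (T.domain : Set H))
include hd

theorem mem_energyEmbedding_graph_iff {x : EnergySpace T hT} {y : H} :
    (x, y) ∈ (energyEmbedding T hT).graph ↔ ∃ f, energyOf T hT f = x ∧ T f = y := by
  rw [energyEmbedding_graph T hT hd]
  constructor
  · rintro ⟨z, hz⟩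
    obtain ⟨f, rfl⟩ := EnergyRange.exists_of T hT z
    exact ⟨f, congrArg Prod.fst hz, congrArg Prod.snd hz⟩
  · rintro ⟨f, rfl, rfl⟩
    exact ⟨EnergyRange.of T hT f, rfl⟩

theorem dense_energyEmbedding_domain :
    Dense ((energyEmbedding T hT).domain : Set (EnergySpace T hT)) := by
  refine (denseRange_energyOf T hT).mono ?_
  rintro _ ⟨f, rfl⟩
  exact mem_domain_of_mem_graph ((mem_energyEmbedding_graph_iff hT hd).2 ⟨f, rfl, rfl⟩)

theorem mem_energyEmbedding_adjoint_graph_iff {x : H} {y : EnergySpace T hT} :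
    (x, y) ∈ (energyEmbedding T hT).adjoint.graph ↔
      ∀ f, inner 𝕜 (T f) x = inner 𝕜 (energyOf T hT f) y := by
  rw [mem_adjoint_graph_iff (dense_energyEmbedding_domain hT hd)]
  constructor
  · exact fun h f => h _ _ ((mem_energyEmbedding_graph_iff hT hd).2 ⟨f, rfl, rfl⟩)
  · intro h u v huv
    obtain ⟨f, rfl, rfl⟩ := (mem_energyEmbedding_graph_iff hT hd).1 huv
    exact h f

theorem energyOf_mem_energyEmbedding_adjoint_graph (f : T.domain) :
    ((f : H), energyOf T hT f) ∈ (energyEmbedding T hT).adjoint.graph :=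
  (mem_energyEmbedding_adjoint_graph_iff hT hd).2 fun g => (inner_energyOf T hT g f).symm

theorem dense_energyEmbedding_adjoint_domain :
    Dense ((energyEmbedding T hT).adjoint.domain : Set H) :=
  hd.mono fun f hf =>
    mem_domain_of_mem_graph (energyOf_mem_energyEmbedding_adjoint_graph hT hd ⟨f, hf⟩)

variable [CompleteSpace H]

theorem mem_energyRestriction_graph_iff {x : H} {y : EnergySpace T hT} :
    (x, y) ∈ (energyRestriction T hT).graph ↔ ∃ f : T.domain, (f : H) = x ∧ energyOf T hT f = y := by
  constructor
  · intro h
    have hx : x ∈ T.domain := (mem_domain_of_mem_graph h).1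
    exact ⟨⟨x, hx⟩, rfl, mem_graph_snd_inj _
      (energyOf_mem_energyEmbedding_adjoint_graph hT hd ⟨x, hx⟩)
      (le_graph_of_le domRestrict_le h) rfl⟩
  · rintro ⟨f, rfl, rfl⟩
    obtain ⟨z, hz, hz'⟩ :=
      (mem_graph_iff _).1 (energyOf_mem_energyEmbedding_adjoint_graph hT hd f)
    refine (mem_graph_iff _).2 ⟨⟨f, f.2, ?_⟩, rfl, ?_⟩
    · exact mem_domain_of_mem_graph (energyOf_mem_energyEmbedding_adjoint_graph hT hd f)
    · exact (domRestrict_apply hz.symm).trans hz'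

theorem dense_energyRestriction_domain : Dense ((energyRestriction T hT).domain : Set H) :=
  hd.mono fun f hf =>
    mem_domain_of_mem_graph ((mem_energyRestriction_graph_iff hT hd).2 ⟨⟨f, hf⟩, rfl, rfl⟩)

/-- By symmetry of `T`, `Q*` extends `J`; in particular it is densely defined, so `Q` is closable.
-/
theorem energyOf_mem_energyRestriction_adjoint_graph (f : T.domain) :
    (energyOf T hT f, T f) ∈ (energyRestriction T hT).adjoint.graph := by
  rw [mem_adjoint_graph_iff (dense_energyRestriction_domain hT hd)]
  intro u v huv
  obtain ⟨g, rfl, rfl⟩ := (mem_energyRestriction_graph_iff hT hd).1 huv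
  rw [inner_energyOf, hT.1]

theorem dense_energyRestriction_adjoint_domain :
    Dense ((energyRestriction T hT).adjoint.domain : Set (EnergySpace T hT)) := by
  refine (denseRange_energyOf T hT).mono ?_
  rintro _ ⟨f, rfl⟩
  exact mem_domain_of_mem_graph (energyOf_mem_energyRestriction_adjoint_graph hT hd f)

theorem closure_energyRestriction_graph_le :
    (energyRestriction T hT).graph.topologicalClosure ≤
      (energyRestriction T hT).adjoint.adjoint.graph :=
  Submodule.topologicalClosure_minimal _
    (le_graph_of_le (le_adjoint_adjoint (dense_energyRestriction_domain hT hd)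
      (dense_energyRestriction_adjoint_domain hT hd)))
    (adjoint_isClosed (dense_energyRestriction_adjoint_domain hT hd))

theorem exists_mem_kreinVonNeumannExtension_graph (h : H) :
    ∃ x y, (x, y) ∈ (energyEmbedding T hT).adjoint.graph ∧
      (y, h - x) ∈ (energyEmbedding T hT).adjoint.adjoint.graph ∧
      (x, h - x) ∈ (T.kreinVonNeumannExtension hT).graph := by
  obtain ⟨x, y, hxy, hy⟩ :=
    exists_mem_closure_graph_of_dense (dense_energyEmbedding_adjoint_domain hT hd) h
  rw [(adjoint_isClosed (dense_energyEmbedding_domain hT hd)).submodule_topologicalClosure_eq]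
    at hxy
  exact ⟨x, y, hxy, hy, (mem_product_graph_iff _ _ _ _).2 ⟨y, hxy, hy⟩⟩

/-- Unlike `J*`, `Q` need not be closed. Membership in the closure of its graph is recorded because
it permits approximation from `dom T` later. -/
theorem exists_mem_friedrichsExtension_graph (h : H) :
    ∃ x y, (x, y) ∈ (energyRestriction T hT).graph.topologicalClosure ∧
      (y, h - x) ∈ (energyRestriction T hT).adjoint.graph ∧
      (x, h - x) ∈ (T.friedrichsExtension hT).graph := by
  obtain ⟨x, y, hxy, hy⟩ :=
    exists_mem_closure_graph_of_dense (dense_energyRestriction_domain hT hd) h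
  exact ⟨x, y, hxy, hy, (mem_product_graph_iff _ _ _ _).2
    ⟨y, closure_energyRestriction_graph_le hT hd hxy, hy⟩⟩

theorem isPositiveSelfAdjoint_kreinVonNeumannExtension :
    (T.kreinVonNeumannExtension hT).IsPositiveSelfAdjoint := by
  refine IsPositiveSymmetric.isPositiveSelfAdjoint (isPositiveSymmetric_product
    (adjoint_isFormalAdjoint (dense_energyEmbedding_adjoint_domain hT hd))) fun h => ?_
  obtain ⟨x, -, -, -, hx⟩ := exists_mem_kreinVonNeumannExtension_graph hT hd h
  exact ⟨x, hx⟩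

theorem isPositiveSelfAdjoint_friedrichsExtension :
    (T.friedrichsExtension hT).IsPositiveSelfAdjoint := by
  refine IsPositiveSymmetric.isPositiveSelfAdjoint (isPositiveSymmetric_product
    (adjoint_isFormalAdjoint (dense_energyRestriction_adjoint_domain hT hd)).symm) fun h => ?_
  obtain ⟨x, -, -, -, hx⟩ := exists_mem_friedrichsExtension_graph hT hd h
  exact ⟨x, hx⟩

theorem le_kreinVonNeumannExtension : T ≤ T.kreinVonNeumannExtension hT := by
  refine le_of_le_graph ?_
  rintro ⟨_, _⟩ hx
  obtain ⟨f, rfl, rfl⟩ := (mem_graph_iff T).1 hx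
  exact (mem_product_graph_iff _ _ _ _).2 ⟨_, energyOf_mem_energyEmbedding_adjoint_graph hT hd f,
    le_graph_of_le (le_adjoint_adjoint (dense_energyEmbedding_domain hT hd)
      (dense_energyEmbedding_adjoint_domain hT hd))
      ((mem_energyEmbedding_graph_iff hT hd).2 ⟨f, rfl, rfl⟩)⟩

theorem le_friedrichsExtension : T ≤ T.friedrichsExtension hT := by
  refine le_of_le_graph ?_
  rintro ⟨_, _⟩ hx
  obtain ⟨f, rfl, rfl⟩ := (mem_graph_iff T).1 hx
  exact (mem_product_graph_iff _ _ _ _).2 ⟨_, closure_energyRestriction_graph_le hT hd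
    (Submodule.le_topologicalClosure _ ((mem_energyRestriction_graph_iff hT hd).2 ⟨f, rfl, rfl⟩)),
    energyOf_mem_energyRestriction_adjoint_graph hT hd f⟩

end Energy

/-! ### Resolvents and the form order. -/

section Resolvent

variable [CompleteSpace H]

/-- Positive self-adjoint operators have no proper positive self-adjoint extensions. -/
theorem IsPositiveSelfAdjoint.eq_of_le {S R : H →ₗ.[𝕜] H} (hS : S.IsPositiveSelfAdjoint)
    (hR : R.IsPositiveSelfAdjoint) (h : S ≤ R) : S = R := by
  refine le_antisymm h (le_of_le_graph ?_)
  rintro ⟨x, y⟩ hxy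
  rw [← hS.2.1, mem_adjoint_graph_iff hS.1]
  exact fun u v huv => hR.2.2.inner_eq (le_graph_of_le h huv) hxy

/-- By maximality `S` is its own Friedrichs extension, for which surjectivity of `1 + S` is already
known. -/
theorem IsPositiveSelfAdjoint.exists_mem_graph {S : H →ₗ.[𝕜] H} (hS : S.IsPositiveSelfAdjoint)
    (h : H) : ∃ x, (x, h - x) ∈ S.graph := by
  obtain ⟨x, -, -, -, hx⟩ := exists_mem_friedrichsExtension_graph hS.2.2 hS.1 h
  rw [← hS.eq_of_le (isPositiveSelfAdjoint_friedrichsExtension hS.2.2 hS.1)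
    (le_friedrichsExtension hS.2.2 hS.1)] at hx
  exact ⟨x, hx⟩

theorem IsPositiveSelfAdjoint.mem_oneAddInverse_graph_iff {S : H →ₗ.[𝕜] H}
    (hS : S.IsPositiveSelfAdjoint) {h x : H} :
    (h, x) ∈ S.oneAddInverse.graph ↔ (x, h - x) ∈ S.graph := by
  have hker : (LinearMap.toPMap (LinearMap.id : H →ₗ[𝕜] H) ⊤ + S).toFun.ker = ⊥ := by
    rw [LinearMap.ker_eq_bot']
    intro z hz
    have := mem_oneAdd_graph_iff.1 ((mem_graph_iff _).2 ⟨z, rfl, hz⟩)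
    rw [zero_sub] at this
    exact Subtype.ext (hS.2.2.eq_zero_of_neg_mem_graph this)
  rw [oneAddInverse, inverse_graph hker, ← mem_oneAdd_graph_iff]
  constructor
  · rintro ⟨⟨a, b⟩, hab, heq⟩
    obtain ⟨rfl, rfl⟩ := Prod.mk.inj heq
    exact hab
  · exact fun hx => ⟨(x, h), hx, rfl⟩

theorem IsPositiveSelfAdjoint.oneAddInverse_domain {S : H →ₗ.[𝕜] H}
    (hS : S.IsPositiveSelfAdjoint) : S.oneAddInverse.domain = ⊤ := by
  refine Submodule.eq_top_iff'.2 fun h => ?_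
  obtain ⟨x, hx⟩ := hS.exists_mem_graph h
  exact mem_domain_of_mem_graph (hS.mem_oneAddInverse_graph_iff.2 hx)

/-- The everywhere defined linear map `(I + S)⁻¹`. -/
def resolvent {S : H →ₗ.[𝕜] H} (hS : S.IsPositiveSelfAdjoint) : H →ₗ[𝕜] H :=
  S.oneAddInverse.toFun.comp
    ((LinearEquiv.ofTop _ hS.oneAddInverse_domain).symm : H →ₗ[𝕜] S.oneAddInverse.domain)

variable {S : H →ₗ.[𝕜] H} (hS : S.IsPositiveSelfAdjoint)

theorem oneAddInverse_apply (h : S.oneAddInverse.domain) :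
    S.oneAddInverse h = resolvent hS (h : H) := rfl

theorem resolvent_mem_graph (h : H) : (resolvent hS h, h - resolvent hS h) ∈ S.graph :=
  hS.mem_oneAddInverse_graph_iff.1 ((mem_graph_iff _).2 
    ⟨⟨h, hS.oneAddInverse_domain ▸ Submodule.mem_top⟩, rfl, rfl⟩)

theorem resolvent_eq_of_mem_graph {h x : H} (hx : (x, h - x) ∈ S.graph) : resolvent hS h = x :=
  hS.2.2.eq_of_mem_graph (resolvent_mem_graph hS h) hx

theorem isSymmetric_resolvent : (resolvent hS).IsSymmetric := by
  intro h k
  have := hS.2.2.inner_eq (resolvent_mem_graph hS h) (resolvent_mem_graph hS k)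
  rw [inner_sub_left, inner_sub_right] at this
  exact (sub_left_injective this).symm

theorem formLE_iff {R : H →ₗ.[𝕜] H} (hR : R.IsPositiveSelfAdjoint) :
    S.FormLE R ↔
      ∀ h, RCLike.re (inner 𝕜 (resolvent hR h) h) ≤ RCLike.re (inner 𝕜 (resolvent hS h) h) := by
  have happly : ∀ h : (S.oneAddInverse - R.oneAddInverse).domain,
      (S.oneAddInverse - R.oneAddInverse) h = resolvent hS (h : H) - resolvent hR (h : H) := by
    intro h
    rw [sub_apply, oneAddInverse_apply hS, oneAddInverse_apply hR]
  constructor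
  · rintro ⟨-, -, h⟩ x
    have := h.2 ⟨x, hS.oneAddInverse_domain ▸ Submodule.mem_top,
      hR.oneAddInverse_domain ▸ Submodule.mem_top⟩
    rw [happly, inner_sub_left, _root_.map_sub] at this
    exact sub_nonneg.1 this
  · refine fun h => ⟨hR.oneAddInverse_domain, hS.oneAddInverse_domain, fun x y => ?_, fun x => ?_⟩
    · rw [happly, happly, inner_sub_left, inner_sub_right, isSymmetric_resolvent hS,
        isSymmetric_resolvent hR]
    · rw [happly, inner_sub_left, _root_.map_sub]
      exact sub_nonneg.2 (h x)

end Resolvent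

/-- A symmetric map with nonnegative form kills every isotropic vector of its form. -/
theorem apply_eq_zero_of_re_inner_eq_zero {D : H →ₗ[𝕜] H} (hD : D.IsSymmetric)
    (hpos : ∀ x, 0 ≤ RCLike.re (inner 𝕜 (D x) x)) {x : H}
    (hx : RCLike.re (inner 𝕜 (D x) x) = 0) : D x = 0 := by
  -- Evaluate the form at `x + t D x`: the constant term vanishes, so the discriminant `(2 ‖D x‖²)²`
  -- must be nonpositive.
  have h : ∀ t : ℝ, 0 ≤ RCLike.re (inner 𝕜 (D (D x)) (D x)) * (t * t) +
      2 * ‖D x‖ ^ 2 * t + 0 := by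
    intro t
    have h1 := hpos (x + (t : 𝕜) • D x)
    have h2 : inner 𝕜 (D (D x)) x = inner 𝕜 (D x) (D x) := hD (D x) x
    simp only [_root_.map_add, _root_.map_smul, inner_add_left, inner_add_right, inner_smul_left,
      inner_smul_right, h2, hx, RCLike.conj_ofReal, RCLike.re_ofReal_mul,
      inner_self_eq_norm_sq] at h1
    linarith
  have h3 := discrim_le_zero h
  rw [discrim] at h3
  have h4 : ‖D x‖ ^ 2 = 0 := by nlinarith [sq_nonneg (‖D x‖ ^ 2)]
  exact norm_eq_zero.1 (pow_eq_zero_iff two_ne_zero |>.1 h4)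

/-! ### Extremality of the two extensions, and the converse. -/

section Extremal

variable [CompleteSpace H] {T S : H →ₗ.[𝕜] H} (hT : T.IsPositiveSymmetric)
  (hd : Dense (T.domain : Set H)) (hS : S.IsPositiveSelfAdjoint)
include hd hS

/-- Cauchy-Schwarz for the form of `S` gives `|⟪x, T f⟫|² ≤ ⟪x, y⟫ ⟪T f, f⟫`, so `x` pairs with `J`
boundedly in the energy norm. -/
theorem exists_mem_energyEmbedding_adjoint_graph_of_le (h : T ≤ S) {x y : H}
    (hxy : (x, y) ∈ S.graph) :
    ∃ z, (x, z) ∈ (energyEmbedding T hT).adjoint.graph ∧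
      ‖z‖ ^ 2 ≤ RCLike.re (inner 𝕜 x y) := by
  have hc := hS.2.2.re_inner_nonneg hxy
  have hbound : ∀ f : T.domain,
      ‖inner 𝕜 x (T f)‖ ≤ √(RCLike.re (inner 𝕜 x y)) * ‖energyOf T hT f‖ := by
    intro f
    have hf : ((f : H), T f) ∈ S.graph := le_graph_of_le h (T.mem_graph f)
    have h1 := hS.2.2.norm_inner_sq_le hxy hf
    rw [hS.2.2.inner_eq hxy hf, ← hT.1, ← inner_energyOf T hT, inner_self_eq_norm_sq] at h1
    refine le_of_sq_le_sq ?_ (by positivity)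
    rwa [mul_pow, Real.sq_sqrt hc]
  have hJ := dense_energyEmbedding_domain hT hd
  have hx : x ∈ (energyEmbedding T hT).adjoint.domain := by
    rw [mem_adjoint_domain_iff]
    refine AddMonoidHomClass.continuous_of_bound _ (√(RCLike.re (inner 𝕜 x y))) fun u => ?_
    obtain ⟨f, hf, hf'⟩ := (mem_energyEmbedding_graph_iff hT hd).1 (mem_graph _ u)
    change ‖inner 𝕜 x (energyEmbedding T hT u)‖ ≤ _ * ‖(u : EnergySpace T hT)‖
    rw [← hf, ← hf']
    exact hbound f
  set z := (energyEmbedding T hT).adjoint ⟨x, hx⟩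
  have hz : (x, z) ∈ (energyEmbedding T hT).adjoint.graph := mem_graph _ ⟨x, hx⟩
  refine ⟨z, hz, ?_⟩
  have hle : ∀ u, ‖inner 𝕜 z u‖ ≤ √(RCLike.re (inner 𝕜 x y)) * ‖u‖ := by
    refine fun u => (denseRange_energyOf T hT).induction_on u
      (isClosed_le (by fun_prop) (by fun_prop)) fun f => ?_
    rw [inner_eq_of_mem_adjoint_graph hJ hz
      ((mem_energyEmbedding_graph_iff hT hd).2 ⟨f, rfl, rfl⟩)]
    exact hbound f
  have h1 := hle z
  rw [inner_self_eq_norm_sq_to_K, norm_pow, RCLike.norm_ofReal, abs_norm] at h1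
  rw [← Real.sq_sqrt hc]
  nlinarith [norm_nonneg z, Real.sqrt_nonneg (RCLike.re (inner 𝕜 x y)),
    sq_nonneg (‖z‖ - √(RCLike.re (inner 𝕜 x y)))]

theorem kreinVonNeumannExtension_formLE_of_le (h : T ≤ S) :
    (T.kreinVonNeumannExtension hT).FormLE S := by
  rw [formLE_iff (isPositiveSelfAdjoint_kreinVonNeumannExtension hT hd) hS]
  intro k
  obtain ⟨z, w, hzw, hw, hz⟩ := exists_mem_kreinVonNeumannExtension_graph hT hd k
  rw [resolvent_eq_of_mem_graph _ hz]
  have hx := resolvent_mem_graph hS k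
  set x := resolvent hS k
  obtain ⟨y, hxy, hy⟩ := exists_mem_energyEmbedding_adjoint_graph_of_le hT hd hS h hx
  have hd' := dense_energyEmbedding_adjoint_domain hT hd
  have h1 := congrArg RCLike.re (inner_eq_of_mem_adjoint_graph hd' hw hxy)
  have h2 := congrArg RCLike.re (inner_eq_of_mem_adjoint_graph hd' hw hzw)
  have h3 := norm_sub_sq (𝕜 := 𝕜) z x
  have h4 := norm_sub_sq (𝕜 := 𝕜) w y
  simp only [inner_sub_left, inner_sub_right, _root_.map_sub, inner_self_eq_norm_sq] at h1 h2 hy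
  -- Expanding `0 ≤ ‖z - x‖² + ‖w - y‖²` bounds it by `re ⟪k, z⟫ - re ⟪k, x⟫`.
  rw [inner_re_symm x k] at *
  rw [inner_re_symm z k]
  nlinarith [sq_nonneg ‖z - x‖, sq_nonneg ‖w - y‖]

theorem formLE_friedrichsExtension_of_le (h : T ≤ S) :
    S.FormLE (T.friedrichsExtension hT) := by
  rw [formLE_iff hS (isPositiveSelfAdjoint_friedrichsExtension hT hd)]
  intro k
  obtain ⟨z, w, hzw, hw, hz⟩ := exists_mem_friedrichsExtension_graph hT hd k
  rw [resolvent_eq_of_mem_graph _ hz]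
  have hx := resolvent_mem_graph hS k
  set x := resolvent hS k
  -- On the graph of `Q` this is positivity of `S` at `f - x` plus `0 ≤ ‖f - x‖²`; continuity
  -- carries it to the closure. At `(z, w)` the left side equals `re ⟪z, k⟫`.
  have hle : ∀ p ∈ (energyRestriction T hT).graph.topologicalClosure,
      2 * RCLike.re (inner 𝕜 p.1 k) - ‖p.1‖ ^ 2 - ‖p.2‖ ^ 2 ≤ RCLike.re (inner 𝕜 x k) := by
    have hcl : _root_.IsClosed {p : H × EnergySpace T hT |
        2 * RCLike.re (inner 𝕜 p.1 k) - ‖p.1‖ ^ 2 - ‖p.2‖ ^ 2 ≤ RCLike.re (inner 𝕜 x k)} :=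
      isClosed_le (by fun_prop) continuous_const
    refine fun p hp => closure_minimal ?_ hcl hp
    rintro ⟨_, _⟩ hp
    obtain ⟨f, rfl, rfl⟩ := (mem_energyRestriction_graph_iff hT hd).1 hp
    have hf : ((f : H), T f) ∈ S.graph := le_graph_of_le h (T.mem_graph f)
    have h1 := hS.2.2.re_inner_nonneg (S.graph.sub_mem hf hx)
    have h2 := congrArg RCLike.re (hS.2.2.inner_eq hx hf)
    have h3 := norm_sub_sq (𝕜 := 𝕜) (f : H) x
    have h4 := congrArg RCLike.re (inner_energyOf T hT f f)
    rw [hT.1] at h4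
    simp only [inner_sub_left, inner_sub_right, _root_.map_sub, inner_self_eq_norm_sq] at h1 h2 h4
    simp only [Set.mem_ofPred_eq]
    rw [inner_re_symm k] at h2
    rw [inner_re_symm x f] at h2
    nlinarith [sq_nonneg ‖(f : H) - x‖]
  have h1 := hle _ hzw
  have h2 := congrArg RCLike.re ((mem_adjoint_graph_iff (dense_energyRestriction_adjoint_domain hT
    hd)).1 (closure_energyRestriction_graph_le hT hd hzw) _ _ hw)
  simp only [inner_sub_left, _root_.map_sub, inner_self_eq_norm_sq] at h1 h2
  rw [inner_re_symm k] at h2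
  linarith

theorem le_of_formLE (h₁ : (T.kreinVonNeumannExtension hT).FormLE S)
    (h₂ : S.FormLE (T.friedrichsExtension hT)) : T ≤ S := by
  have hN := isPositiveSelfAdjoint_kreinVonNeumannExtension hT hd
  have hF := isPositiveSelfAdjoint_friedrichsExtension hT hd
  rw [formLE_iff hN hS] at h₁
  rw [formLE_iff hS hF] at h₂
  refine le_of_le_graph ?_
  rintro ⟨f, g⟩ hfg
  have hN' : resolvent hN (f + g) = f := resolvent_eq_of_mem_graph hN (by
    rw [add_sub_cancel_left]; exact le_graph_of_le (le_kreinVonNeumannExtension hT hd) hfg)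
  have hF' : resolvent hF (f + g) = f := resolvent_eq_of_mem_graph hF (by
    rw [add_sub_cancel_left]; exact le_graph_of_le (le_friedrichsExtension hT hd) hfg)
  have h0 : (resolvent hS - resolvent hF) (f + g) = 0 := by
    refine apply_eq_zero_of_re_inner_eq_zero
      ((isSymmetric_resolvent hS).sub (isSymmetric_resolvent hF)) (fun x => ?_) ?_
    · rw [LinearMap.sub_apply, inner_sub_left, _root_.map_sub]
      exact sub_nonneg.2 (h₂ x)
    · have h3 := h₁ (f + g)
      have h4 := h₂ (f + g)
      rw [hN'] at h3
      rw [LinearMap.sub_apply, inner_sub_left, _root_.map_sub]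
      rw [hF'] at h4 ⊢
      linarith
  rw [LinearMap.sub_apply, hF', sub_eq_zero] at h0
  have h5 := resolvent_mem_graph hS (f + g)
  rwa [h0, add_sub_cancel_left] at h5

end Extremal

end LinearPMap

end

theorem mainTheorem4 {𝕜 H : Type*} [RCLike 𝕜] [NormedAddCommGroup H] [InnerProductSpace 𝕜 H]
    [CompleteSpace H] (T : H →ₗ.[𝕜] H) (hT : T.IsPositiveSymmetric)
    (hd : Dense (T.domain : Set H)) :
    (T.kreinVonNeumannExtension hT).IsPositiveSelfAdjoint ∧ T ≤ T.kreinVonNeumannExtension hT ∧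
    (T.friedrichsExtension hT).IsPositiveSelfAdjoint ∧ T ≤ T.friedrichsExtension hT ∧
    {S : H →ₗ.[𝕜] H | S.IsPositiveSelfAdjoint ∧ T ≤ S} =
      {S : H →ₗ.[𝕜] H | S.IsPositiveSelfAdjoint ∧
        (T.kreinVonNeumannExtension hT).FormLE S ∧ S.FormLE (T.friedrichsExtension hT)} := by
  refine ⟨LinearPMap.isPositiveSelfAdjoint_kreinVonNeumannExtension hT hd,
    LinearPMap.le_kreinVonNeumannExtension hT hd,
    LinearPMap.isPositiveSelfAdjoint_friedrichsExtension hT hd,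
    LinearPMap.le_friedrichsExtension hT hd, Set.ext fun S => ⟨?_, ?_⟩⟩
  · rintro ⟨hS, h⟩
    exact ⟨hS, LinearPMap.kreinVonNeumannExtension_formLE_of_le hT hd hS h,
      LinearPMap.formLE_friedrichsExtension_of_le hT hd hS h⟩
  · rintro ⟨hS, h₁, h₂⟩
    exact ⟨hS, LinearPMap.le_of_formLE hT hd hS h₁ h₂⟩
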